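/- Let $n\ge 0$ be an integer and $\hbar>0$. For $L^2(\mathbb R^n)=L^2(\mathbb R^n;\mathbb C)$, the metaplectic group $\operatorname{Mp}(n)$ is the group of unitary operators on $L^2(\mathbb R^n)$ generated by the following operators: * $\widehat V_{-P}\psi(x)=e^{\frac{i}{2\hbar}Px\cdot x}\psi(x)$, for every real symmetric $n\times n$ matrix $P$; * $\widehat M_{L,m}\psi(x)=i^{m}\sqrt{|\det L|}\,\psi(Lx)$, for every real $n\times n$ matrix $L$ with $\det L\neq 0$ and every integer $m$ such that $m\pi$ is a choice of $\arg\det L$ (that is, $m$ is even if $\det L>0$ and odd if $\det L<0$); * $\widehat J\psi(x)=\left(\frac{1}{2\pi i\hbar}\right)^{n/2}\int_{\mathbb R^n}e^{-\frac{i}{\hbar}x\cdot x'}\psi(x')\,dx'$ (extended from the Schwartz space to $L^2(\mathbb R^n)$ by continuity, with $i^{-n/2}=e^{-i\pi n/4}$). For real symmetric $n\times n$ matrices $X,Y$ with $X$ positive definite, and $\gamma\in\mathbb R$, let $$\psi_{X,Y}^{\gamma}(x)=i^{\gamma}\left(\tfrac{1}{\pi\hbar}\right)^{n/4}(\det X)^{1/4}e^{-\frac{1}{2\hbar}(X+iY)x\cdot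 x},\qquad i^{\gamma}=e^{i\pi\gamma/2},\qquad \psi_{X,Y}=\psi_{X,Y}^{0},$$ and let $\operatorname{Gauss}_0(n)\subset L^2(\mathbb R^n)$ be the set of all these (centered, $L^2$-normalized) functions $\psi_{X,Y}^{\gamma}$. Then $\operatorname{Mp}(n)$ acts on $\operatorname{Gauss}_0(n)$, transitively on the Gaussians $\psi_{X,Y}$ up to a unimodular factor: 1. for every $\widehat S\in\operatorname{Mp}(n)$ and every $\psi\in\operatorname{Gauss}_0(n)$ one has $\widehat S\psi\in\operatorname{Gauss}_0(n)$; 2. for any two Gaussians $\psi_{X,Y}$ and $\psi_{X',Y'}$ as above there exist $\widehat S\in\operatorname{Mp}(n)$ and $\gamma\in\mathbb R$ such that $\widehat S\psi_{X,Y}=i^{\gamma}\psi_{X',Y'}$. -/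

import Mathlib

open MeasureTheory
open scoped FourierTransform SchwartzMap

noncomputable section

namespace Metaplectic

/-- The configuration space `ℝⁿ`. -/
abbrev Conf (n : ℕ) : Type := EuclideanSpace ℝ (Fin n)

/-- The Hilbert space `L²(ℝⁿ; ℂ)`. -/
abbrev L2 (n : ℕ) : Type := Lp ℂ 2 (volume : Measure (Conf n))

/-- The quadratic form `x ↦ Ax · x` of a real `n × n` matrix. -/
def quad {n : ℕ} (A : Matrix (Fin n) (Fin n) ℝ) (x : Conf n) : ℝ :=
  inner ℝ (Matrix.toEuclideanLin A x) x

theorem continuous_quad {n : ℕ} (A : Matrix (Fin n) (Fin n) ℝ) : Continuous (quad A) := by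
  have h := (Matrix.toEuclideanLin A).continuous_of_finiteDimensional
  unfold quad
  fun_prop

/-! ### Weighted changes of variables on `L²` -/

theorem map_linearEquiv {n : ℕ} (A : Conf n ≃ₗ[ℝ] Conf n) :
    Measure.map A (volume : Measure (Conf n)) =
      ENNReal.ofReal |(LinearMap.det (A : Conf n →ₗ[ℝ] Conf n))⁻¹| • volume :=
  Measure.map_linearMap_addHaar_eq_smul_addHaar (f := (A : Conf n →ₗ[ℝ] Conf n)) volume
    (LinearEquiv.isUnit_det' A).ne_zero

theorem continuous_linearEquiv {n : ℕ} (A : Conf n ≃ₗ[ℝ] Conf n) : Continuous A :=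
  (A : Conf n →ₗ[ℝ] Conf n).continuous_of_finiteDimensional

theorem quasi_linearEquiv {n : ℕ} (A : Conf n ≃ₗ[ℝ] Conf n) :
    Measure.QuasiMeasurePreserving A (volume : Measure (Conf n)) volume := by
  refine ⟨(continuous_linearEquiv A).measurable, ?_⟩
  rw [map_linearEquiv]
  exact Measure.smul_absolutelyContinuous

theorem eLpNorm_weighted {n : ℕ} (A : Conf n ≃ₗ[ℝ] Conf n) (w : Conf n → ℂ)
    (hw : ∀ x, ‖w x‖ = √|LinearMap.det (A : Conf n →ₗ[ℝ] Conf n)|)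
    (f : Conf n → ℂ) (hf : AEStronglyMeasurable f volume) :
    eLpNorm (fun x => w x * f (A x)) 2 volume = eLpNorm f 2 volume := by
  set d := LinearMap.det (A : Conf n →ₗ[ℝ] Conf n) with hd
  have hd0 : d ≠ 0 := (LinearEquiv.isUnit_det' A).ne_zero
  have h1 : eLpNorm (fun x => w x * f (A x)) 2 volume
      = eLpNorm (√|d| • (f ∘ A)) 2 volume := by
    refine eLpNorm_congr_norm_ae (Filter.Eventually.of_forall fun x => ?_)
    simp [hw, abs_of_nonneg (Real.sqrt_nonneg _)]
  have hmap : AEStronglyMeasurable f (Measure.map A volume) := by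
    rw [map_linearEquiv]
    exact hf.mono_ac Measure.smul_absolutelyContinuous
  have h2 := eLpNorm_map_measure (p := 2) hmap (continuous_linearEquiv A).aemeasurable
  rw [map_linearEquiv, eLpNorm_smul_measure_of_ne_top (by simp)] at h2
  rw [h1, eLpNorm_const_smul, ← h2, smul_eq_mul, ← mul_assoc]
  have h3 : ‖√|d|‖ₑ * ENNReal.ofReal |d⁻¹| ^ (1 / (2 : ENNReal)).toReal = 1 := by
    rw [Real.enorm_eq_ofReal (Real.sqrt_nonneg _),
      ENNReal.ofReal_rpow_of_nonneg (abs_nonneg _) (by positivity),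
      ← ENNReal.ofReal_mul (Real.sqrt_nonneg _)]
    have : (1 / (2 : ENNReal)).toReal = 1 / 2 := by simp
    rw [this, ← Real.sqrt_eq_rpow, ← Real.sqrt_mul (abs_nonneg _), ← abs_mul,
      mul_inv_cancel₀ hd0]
    simp
  rw [← hd, h3, one_mul]

theorem memLp_weighted {n : ℕ} (A : Conf n ≃ₗ[ℝ] Conf n) (w : Conf n → ℂ) (hc : Continuous w)
    (hw : ∀ x, ‖w x‖ = √|LinearMap.det (A : Conf n →ₗ[ℝ] Conf n)|)
    (f : Conf n → ℂ) (hf : MemLp f 2 volume) :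
    MemLp (fun x => w x * f (A x)) 2 volume :=
  ⟨hc.aestronglyMeasurable.mul (hf.1.comp_quasiMeasurePreserving (quasi_linearEquiv A)),
    by rw [eLpNorm_weighted A w hw f hf.1]; exact hf.2⟩

/-- For a linear automorphism `A` of `ℝⁿ` and a continuous weight with `|w(x)|² = |det A|`, the
isometry `ψ ↦ w(x) ψ(Ax)` of `L²(ℝⁿ)`. -/
def weightedIso {n : ℕ} (A : Conf n ≃ₗ[ℝ] Conf n) (w : Conf n → ℂ) (hc : Continuous w)
    (hw : ∀ x, ‖w x‖ = √|LinearMap.det (A : Conf n →ₗ[ℝ] Conf n)|) :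
    L2 n →ₗᵢ[ℂ] L2 n where
  toFun ψ := (memLp_weighted A w hc hw ψ (Lp.memLp ψ)).toLp
  map_add' ψ φ := by
    rw [← MemLp.toLp_add, MemLp.toLp_eq_toLp_iff]
    filter_upwards [(quasi_linearEquiv A).ae (Lp.coeFn_add ψ φ)] with x hx
    simp only [Pi.add_apply] at hx ⊢
    rw [hx, mul_add]
  map_smul' c ψ := by
    rw [RingHom.id_apply, ← MemLp.toLp_const_smul, MemLp.toLp_eq_toLp_iff]
    filter_upwards [(quasi_linearEquiv A).ae (Lp.coeFn_smul c ψ)] with x hx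
    simp only [Pi.smul_apply, smul_eq_mul] at hx ⊢
    rw [hx]; ring
  norm_map' ψ := by
    change ‖(memLp_weighted A w hc hw ψ (Lp.memLp ψ)).toLp‖ = _
    rw [Lp.norm_toLp, eLpNorm_weighted A w hw ψ (Lp.memLp ψ).1, Lp.norm_def]

theorem weightedIso_coeFn {n : ℕ} (A : Conf n ≃ₗ[ℝ] Conf n) (w : Conf n → ℂ) (hc : Continuous w)
    (hw : ∀ x, ‖w x‖ = √|LinearMap.det (A : Conf n →ₗ[ℝ] Conf n)|) (ψ : L2 n) :
    (weightedIso A w hc hw ψ : Conf n → ℂ) =ᵐ[volume] fun x => w x * ψ (A x) :=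
  (memLp_weighted A w hc hw ψ (Lp.memLp ψ)).coeFn_toLp

theorem weightedIso_surjective {n : ℕ} (A : Conf n ≃ₗ[ℝ] Conf n) (w : Conf n → ℂ)
    (hc : Continuous w) (hw : ∀ x, ‖w x‖ = √|LinearMap.det (A : Conf n →ₗ[ℝ] Conf n)|) :
    Function.Surjective (weightedIso A w hc hw) := by
  intro φ
  have hd0 : LinearMap.det (A : Conf n →ₗ[ℝ] Conf n) ≠ 0 := (LinearEquiv.isUnit_det' A).ne_zero
  have hw0 : ∀ x, w x ≠ 0 := fun x h => by
    have := hw x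
    rw [h, norm_zero, eq_comm, Real.sqrt_eq_zero (abs_nonneg _), abs_eq_zero] at this
    exact hd0 this
  have hc' : Continuous fun y => (w (A.symm y))⁻¹ :=
    (hc.comp (continuous_linearEquiv A.symm)).inv₀ fun y => hw0 _
  have hw' : ∀ y, ‖(w (A.symm y))⁻¹‖ = √|LinearMap.det (A.symm : Conf n →ₗ[ℝ] Conf n)| := by
    intro y
    rw [norm_inv, hw, ← Real.sqrt_inv, ← abs_inv, LinearEquiv.det_coe_symm]
  refine ⟨weightedIso A.symm (fun y => (w (A.symm y))⁻¹) hc' hw' φ, ?_⟩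
  refine Lp.ext ?_
  filter_upwards [weightedIso_coeFn A w hc hw
      (weightedIso A.symm (fun y => (w (A.symm y))⁻¹) hc' hw' φ),
    (quasi_linearEquiv A).ae
      (weightedIso_coeFn A.symm (fun y => (w (A.symm y))⁻¹) hc' hw' φ)] with x h1 h2
  rw [h1, h2]
  simp [hw0]

/-- The unitary operator `ψ ↦ w(x) ψ(Ax)` of `L²(ℝⁿ)`, where `|w(x)|² = |det A|`. -/
def weightedEquiv {n : ℕ} (A : Conf n ≃ₗ[ℝ] Conf n) (w : Conf n → ℂ) (hc : Continuous w)
    (hw : ∀ x, ‖w x‖ = √|LinearMap.det (A : Conf n →ₗ[ℝ] Conf n)|) :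
    L2 n ≃ₗᵢ[ℂ] L2 n :=
  LinearIsometryEquiv.ofSurjective (weightedIso A w hc hw) (weightedIso_surjective A w hc hw)

theorem weightedEquiv_coeFn {n : ℕ} (A : Conf n ≃ₗ[ℝ] Conf n) (w : Conf n → ℂ)
    (hc : Continuous w) (hw : ∀ x, ‖w x‖ = √|LinearMap.det (A : Conf n →ₗ[ℝ] Conf n)|)
    (ψ : L2 n) :
    (weightedEquiv A w hc hw ψ : Conf n → ℂ) =ᵐ[volume] fun x => w x * ψ (A x) :=
  weightedIso_coeFn A w hc hw ψ

/-! ### The generators of the metaplectic group -/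

/-- The operator `V̂_{-P}ψ(x) = exp((i/2ħ) Px·x) ψ(x)` (for `P` symmetric). -/
def opV {n : ℕ} (ħ : ℝ) (P : Matrix (Fin n) (Fin n) ℝ) : L2 n ≃ₗᵢ[ℂ] L2 n :=
  weightedEquiv (LinearEquiv.refl ℝ (Conf n))
    (fun x => Complex.exp (Complex.I / (2 * (ħ : ℂ)) * (quad P x : ℂ)))
    (by have := continuous_quad P; fun_prop)
    (fun x => by
      have : Complex.I / (2 * (ħ : ℂ)) * (quad P x : ℂ)
          = ((quad P x / (2 * ħ) : ℝ) : ℂ) * Complex.I := by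
        push_cast; ring
      rw [this, Complex.norm_exp_ofReal_mul_I]
      simp)

theorem opV_coeFn {n : ℕ} (ħ : ℝ) (P : Matrix (Fin n) (Fin n) ℝ) (ψ : L2 n) :
    (opV ħ P ψ : Conf n → ℂ) =ᵐ[volume]
      fun x => Complex.exp (Complex.I / (2 * (ħ : ℂ)) * (quad P x : ℂ)) * ψ x :=
  weightedEquiv_coeFn _ _ _ _ ψ

theorem det_toEuclideanLin {n : ℕ} (L : Matrix (Fin n) (Fin n) ℝ) :
    LinearMap.det (Matrix.toEuclideanLin L) = L.det :=
  LinearMap.det_toLpLin 2 L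

/-- The automorphism `x ↦ Lx` of `ℝⁿ` given by a matrix with `det L ≠ 0`. -/
def linEquiv {n : ℕ} (L : Matrix (Fin n) (Fin n) ℝ) (hL : L.det ≠ 0) : Conf n ≃ₗ[ℝ] Conf n :=
  LinearMap.equivOfDetNeZero (Matrix.toEuclideanLin L) (by rwa [det_toEuclideanLin])

theorem linEquiv_coe {n : ℕ} (L : Matrix (Fin n) (Fin n) ℝ) (hL : L.det ≠ 0) :
    (linEquiv L hL : Conf n →ₗ[ℝ] Conf n) = Matrix.toEuclideanLin L := by
  ext x
  rfl

theorem det_linEquiv {n : ℕ} (L : Matrix (Fin n) (Fin n) ℝ) (hL : L.det ≠ 0) :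
    LinearMap.det (linEquiv L hL : Conf n →ₗ[ℝ] Conf n) = L.det := by
  rw [linEquiv_coe, det_toEuclideanLin]

/-- The operator `M̂_{L,m}ψ(x) = iᵐ √|det L| ψ(Lx)`. -/
def opM {n : ℕ} (L : Matrix (Fin n) (Fin n) ℝ) (hL : L.det ≠ 0) (m : ℤ) : L2 n ≃ₗᵢ[ℂ] L2 n :=
  weightedEquiv (linEquiv L hL) (fun _ => Complex.I ^ m * (√|L.det| : ℂ)) continuous_const
    (fun x => by
      rw [det_linEquiv, norm_mul, norm_zpow, Complex.norm_I, one_zpow, one_mul,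
        Complex.norm_real, Real.norm_of_nonneg (Real.sqrt_nonneg _)])

theorem opM_coeFn {n : ℕ} (L : Matrix (Fin n) (Fin n) ℝ) (hL : L.det ≠ 0) (m : ℤ) (ψ : L2 n) :
    (opM L hL m ψ : Conf n → ℂ) =ᵐ[volume]
      fun x => Complex.I ^ m * (√|L.det| : ℂ) * ψ (Matrix.toEuclideanLin L x) :=
  weightedEquiv_coeFn _ _ _ _ ψ

/-- The constant `(1 / 2πiħ)^{n/2}` (principal branch, so that `i^{-n/2} = e^{-iπn/4}`). -/
def constJ (n : ℕ) (ħ : ℝ) : ℂ :=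
  (1 / (2 * (Real.pi : ℂ) * Complex.I * (ħ : ℂ))) ^ ((n : ℂ) / 2)

/-- The automorphism `x ↦ x / (2πħ)` of `ℝⁿ`. -/
def scaleEquiv (n : ℕ) {ħ : ℝ} (hħ : 0 < ħ) : Conf n ≃ₗ[ℝ] Conf n :=
  LinearEquiv.smulOfNeZero ℝ (Conf n) (2 * Real.pi * ħ)⁻¹ (by positivity)

theorem norm_constJ (n : ℕ) {ħ : ℝ} (hħ : 0 < ħ) :
    ‖constJ n ħ‖ = √|LinearMap.det (scaleEquiv n hħ : Conf n →ₗ[ℝ] Conf n)| := by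
  have hpos : 0 < 2 * Real.pi * ħ := by positivity
  have h1 : (scaleEquiv n hħ : Conf n →ₗ[ℝ] Conf n) = (2 * Real.pi * ħ)⁻¹ • LinearMap.id := by
    ext x; rfl
  have hz : (1 / (2 * (Real.pi : ℂ) * Complex.I * (ħ : ℂ))) ≠ 0 := by
    have : (ħ : ℂ) ≠ 0 := by exact_mod_cast hħ.ne'
    have : (Real.pi : ℂ) ≠ 0 := by exact_mod_cast Real.pi_ne_zero
    simp_all
  have him : ((n : ℂ) / 2).im = 0 := by
    have : ((n : ℂ) / 2) = (((n : ℝ) / 2 : ℝ) : ℂ) := by push_cast; rfl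
    rw [this, Complex.ofReal_im]
  have hre : ((n : ℂ) / 2).re = (n : ℝ) / 2 := by
    have : ((n : ℂ) / 2) = (((n : ℝ) / 2 : ℝ) : ℂ) := by push_cast; rfl
    rw [this, Complex.ofReal_re]
  have hn : ‖(1 / (2 * (Real.pi : ℂ) * Complex.I * (ħ : ℂ)))‖ = (2 * Real.pi * ħ)⁻¹ := by
    simp [abs_of_pos Real.pi_pos, abs_of_pos hħ]
  rw [constJ, Complex.norm_cpow_of_ne_zero hz, him, hre, hn, mul_zero, Real.exp_zero, div_one, h1,
    LinearMap.det_smul, LinearMap.det_id, mul_one, finrank_euclideanSpace_fin,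
    abs_of_pos (by positivity), Real.sqrt_eq_rpow, ← Real.rpow_natCast, ← Real.rpow_mul
    (by positivity)]
  congr 1
  ring

/-- The operator `Ĵ`, essentially the Fourier transform. In terms of the Plancherel extension of
`𝓕ψ(ξ) = ∫ exp(-2πi ξ·y) ψ(y) dy` it is `Ĵψ(x) = (1/2πiħ)^{n/2} 𝓕ψ(x/2πħ)`; see
`opJ_schwartz` for the formula as an integral. -/
def opJ (n : ℕ) {ħ : ℝ} (hħ : 0 < ħ) : L2 n ≃ₗᵢ[ℂ] L2 n :=
  (Lp.fourierTransformₗᵢ (Conf n) ℂ).trans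
    (weightedEquiv (scaleEquiv n hħ) (fun _ => constJ n ħ) continuous_const
      (fun _ => norm_constJ n hħ))

/-- `Ĵψ(x) = (1/2πiħ)^{n/2} ∫ exp(-(i/ħ) x·y) ψ(y) dy` for `ψ` in the Schwartz space, which is
dense in `L²(ℝⁿ)`. -/
theorem opJ_schwartz (n : ℕ) {ħ : ℝ} (hħ : 0 < ħ) (ψ : 𝓢(Conf n, ℂ)) :
    (opJ n hħ (ψ.toLp 2) : Conf n → ℂ) =ᵐ[volume]
      fun x => constJ n ħ *
        ∫ y, Complex.exp (-(Complex.I / (ħ : ℂ)) * (inner ℝ x y : ℂ)) * ψ y := by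
  have h0 : opJ n hħ (ψ.toLp 2) = weightedEquiv (scaleEquiv n hħ) (fun _ => constJ n ħ)
      continuous_const (fun _ => norm_constJ n hħ) (𝓕 (ψ.toLp 2)) := rfl
  rw [h0, SchwartzMap.toLp_fourier_eq]
  filter_upwards [weightedEquiv_coeFn (scaleEquiv n hħ) (fun _ => constJ n ħ)
    continuous_const (fun _ => norm_constJ n hħ) ((𝓕 ψ).toLp 2),
    (quasi_linearEquiv (scaleEquiv n hħ)).ae ((𝓕 ψ).coeFn_toLp 2 volume)] with x h1 h2
  rw [h1, h2, SchwartzMap.fourier_coe, Real.fourier_eq']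
  congr 1
  refine integral_congr_ae (Filter.Eventually.of_forall fun y => ?_)
  have hs : scaleEquiv n hħ x = (2 * Real.pi * ħ)⁻¹ • x := rfl
  have hħ' : (ħ : ℂ) ≠ 0 := by exact_mod_cast hħ.ne'
  have hπ : (Real.pi : ℂ) ≠ 0 := by exact_mod_cast Real.pi_ne_zero
  simp only [hs, inner_smul_right, smul_eq_mul, real_inner_comm y x]
  congr 2
  push_cast
  field_simp

/-- The metaplectic group `Mp(n)`: the group of unitary operators on `L²(ℝⁿ)` generated by the
`V̂_{-P}` with `P` symmetric, the `M̂_{L,m}` with `det L ≠ 0` and `mπ` a choice of `arg det L`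
(that is, `m` even for `det L > 0` and odd for `det L < 0`), and `Ĵ`. -/
def Mp (n : ℕ) {ħ : ℝ} (hħ : 0 < ħ) : Subgroup (L2 n ≃ₗᵢ[ℂ] L2 n) :=
  Subgroup.closure
    ({S | ∃ P : Matrix (Fin n) (Fin n) ℝ, P.IsSymm ∧ S = opV ħ P} ∪
      {S | ∃ (L : Matrix (Fin n) (Fin n) ℝ) (hL : L.det ≠ 0) (m : ℤ),
        (Even m ↔ 0 < L.det) ∧ S = opM L hL m} ∪
      {opJ n hħ})

/-! ### Generalized Gaussians -/

/-- The function
`ψ_{X,Y}^γ(x) = i^γ (1/πħ)^{n/4} (det X)^{1/4} exp(-(1/2ħ) (X + iY)x·x)`. -/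
def gaussFun {n : ℕ} (ħ : ℝ) (X Y : Matrix (Fin n) (Fin n) ℝ) (γ : ℝ) (x : Conf n) : ℂ :=
  Complex.I ^ (γ : ℂ) * (((1 / (Real.pi * ħ)) ^ ((n : ℝ) / 4) * X.det ^ ((1 : ℝ) / 4) : ℝ) : ℂ) *
    Complex.exp (-(1 / (2 * (ħ : ℂ))) * ((quad X x : ℂ) + Complex.I * (quad Y x : ℂ)))

theorem norm_I_cpow (γ : ℝ) : ‖Complex.I ^ (γ : ℂ)‖ = 1 := by
  rw [Complex.norm_cpow_of_ne_zero Complex.I_ne_zero]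
  simp

/-- The standard Gaussian `φ₀(x) = (πħ)^{-n/4} exp(-|x|²/2ħ)` is in `L²` with norm one. -/
theorem stdGauss_aux (n : ℕ) {ħ : ℝ} (hħ : 0 < ħ) :
    MemLp (fun x : Conf n =>
      (((1 / (Real.pi * ħ)) ^ ((n : ℝ) / 4) * Real.exp (-(1 / (2 * ħ)) * ‖x‖ ^ 2) : ℝ) : ℂ))
        2 volume ∧
    eLpNorm (fun x : Conf n =>
      (((1 / (Real.pi * ħ)) ^ ((n : ℝ) / 4) * Real.exp (-(1 / (2 * ħ)) * ‖x‖ ^ 2) : ℝ) : ℂ))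
        2 volume = 1 := by
  have hsq : ∀ x : Conf n,
      ‖(((1 / (Real.pi * ħ)) ^ ((n : ℝ) / 4) * Real.exp (-(1 / (2 * ħ)) * ‖x‖ ^ 2) : ℝ) : ℂ)‖ ^ 2
      = (1 / (Real.pi * ħ)) ^ ((n : ℝ) / 2) * Real.exp (-(1 / ħ) * ‖x‖ ^ 2) := by
    intro x
    rw [Complex.norm_real, Real.norm_of_nonneg (by positivity), mul_pow, ← Real.exp_nat_mul,
      ← Real.rpow_natCast ((1 / (Real.pi * ħ)) ^ ((n : ℝ) / 4)), ← Real.rpow_mul (by positivity)]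
    congr 2
    · push_cast; ring
    · push_cast; field_simp
  have hint : Integrable (fun x : Conf n => Real.exp (-(1 / ħ) * ‖x‖ ^ 2)) volume := by
    have h := (GaussianFourier.integrable_cexp_neg_mul_sq_norm_add (V := Conf n)
      (b := ((1 / ħ : ℝ) : ℂ)) (by rw [Complex.ofReal_re]; positivity) 0 0).norm
    refine h.congr (Filter.Eventually.of_forall fun x => ?_)
    simp only [Complex.norm_exp]
    congr 1
    rw [inner_zero_left, Complex.ofReal_zero, mul_zero, add_zero, ← Complex.ofReal_pow,
      ← Complex.ofReal_neg, ← Complex.ofReal_mul, Complex.ofReal_re]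
  have hmem : MemLp (fun x : Conf n =>
      (((1 / (Real.pi * ħ)) ^ ((n : ℝ) / 4) * Real.exp (-(1 / (2 * ħ)) * ‖x‖ ^ 2) : ℝ) : ℂ))
        2 volume := by
    rw [memLp_two_iff_integrable_sq_norm (by
      apply Continuous.aestronglyMeasurable; fun_prop)]
    simp_rw [hsq]
    exact hint.const_mul _
  refine ⟨hmem, ?_⟩
  rw [hmem.eLpNorm_eq_integral_rpow_norm (by simp) (by simp)]
  have h2 : (2 : ENNReal).toReal = ((2 : ℕ) : ℝ) := by simp
  simp_rw [h2, Real.rpow_natCast, hsq]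
  rw [integral_const_mul, GaussianFourier.integral_rexp_neg_mul_sq_norm (by positivity),
    finrank_euclideanSpace_fin, ← Real.mul_rpow (by positivity) (by positivity)]
  have : 1 / (Real.pi * ħ) * (Real.pi / (1 / ħ)) = 1 := by
    field_simp
  rw [this]
  simp

theorem exists_factor {n : ℕ} {X : Matrix (Fin n) (Fin n) ℝ} (hX : X.PosDef) :
    ∃ B : Matrix (Fin n) (Fin n) ℝ, B.det ≠ 0 ∧ X.det = B.det ^ 2 ∧
      ∀ x, quad X x = ‖Matrix.toEuclideanLin B x‖ ^ 2 := by
  obtain ⟨B, hB⟩ : ∃ B : Matrix (Fin n) (Fin n) ℝ, X = B.conjTranspose * B := by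
    open scoped MatrixOrder Matrix.Norms.L2Operator in
    exact CStarAlgebra.nonneg_iff_eq_star_mul_self.mp hX.posSemidef.nonneg
  have hdet : X.det = B.det ^ 2 := by
    rw [hB, Matrix.det_mul, Matrix.det_conjTranspose, star_trivial, sq]
  refine ⟨B, fun h => ?_, hdet, fun x => ?_⟩
  · have := hX.det_pos
    rw [hdet, h] at this
    simp at this
  · rw [quad, hB, Matrix.toLpLin_mul_same, Matrix.toEuclideanLin_conjTranspose_eq_adjoint,
      LinearMap.comp_apply, LinearMap.adjoint_inner_left, real_inner_self_eq_norm_sq]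

theorem gaussFun_aux {n : ℕ} {ħ : ℝ} (hħ : 0 < ħ) {X : Matrix (Fin n) (Fin n) ℝ} (hX : X.PosDef)
    (Y : Matrix (Fin n) (Fin n) ℝ) (γ : ℝ) :
    MemLp (gaussFun ħ X Y γ) 2 volume ∧ eLpNorm (gaussFun ħ X Y γ) 2 volume = 1 := by
  obtain ⟨B, hB0, hdet, hq⟩ := exists_factor hX
  obtain ⟨h1, h2⟩ := stdGauss_aux n hħ
  set w : Conf n → ℂ := fun x => Complex.I ^ (γ : ℂ) * ((X.det ^ ((1 : ℝ) / 4) : ℝ) : ℂ) *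
    Complex.exp (((-(quad Y x / (2 * ħ)) : ℝ) : ℂ) * Complex.I) with hw
  have hc : Continuous w := by have := continuous_quad Y; fun_prop
  have hwn : ∀ x, ‖w x‖ = √|LinearMap.det (linEquiv B hB0 : Conf n →ₗ[ℝ] Conf n)| := by
    intro x
    have hp := hX.det_pos
    rw [hw, det_linEquiv]
    simp only [norm_mul]
    rw [norm_I_cpow, Complex.norm_exp_ofReal_mul_I, one_mul, mul_one, Complex.norm_real,
      Real.norm_of_nonneg (by positivity), hdet, ← sq_abs, ← Real.rpow_natCast, ← Real.rpow_mul
      (abs_nonneg _), Real.sqrt_eq_rpow]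
    norm_num
  have hfun : gaussFun ħ X Y γ = fun x => w x *
      (fun x : Conf n => (((1 / (Real.pi * ħ)) ^ ((n : ℝ) / 4) *
        Real.exp (-(1 / (2 * ħ)) * ‖x‖ ^ 2) : ℝ) : ℂ)) (linEquiv B hB0 x) := by
    funext x
    have hBx : linEquiv B hB0 x = Matrix.toEuclideanLin B x := rfl
    have hexp : Complex.exp (-(1 / (2 * (ħ : ℂ))) * ((quad X x : ℂ) + Complex.I * (quad Y x : ℂ)))
        = Complex.exp (((-(quad Y x / (2 * ħ)) : ℝ) : ℂ) * Complex.I) *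
          Complex.exp ((-(1 / (2 * ħ)) * quad X x : ℝ) : ℂ) := by
      rw [← Complex.exp_add]
      congr 1
      push_cast
      ring
    simp only [gaussFun, hw, hBx, ← hq]
    rw [hexp]
    push_cast
    ring
  rw [hfun]
  exact ⟨memLp_weighted _ w hc hwn _ h1, by rw [eLpNorm_weighted _ w hwn _ h1.1, h2]⟩

/-- The generalized Gaussian `ψ_{X,Y}^γ` (for `X > 0`) as an element of `L²(ℝⁿ)`. -/
def gauss {n : ℕ} {ħ : ℝ} (hħ : 0 < ħ) {X : Matrix (Fin n) (Fin n) ℝ} (hX : X.PosDef)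
    (Y : Matrix (Fin n) (Fin n) ℝ) (γ : ℝ) : L2 n :=
  (gaussFun_aux hħ hX Y γ).1.toLp

/-- The generalized Gaussians are normalized. -/
theorem norm_gauss {n : ℕ} {ħ : ℝ} (hħ : 0 < ħ) {X : Matrix (Fin n) (Fin n) ℝ} (hX : X.PosDef)
    (Y : Matrix (Fin n) (Fin n) ℝ) (γ : ℝ) : ‖gauss hħ hX Y γ‖ = 1 := by
  rw [gauss, Lp.norm_toLp, (gaussFun_aux hħ hX Y γ).2, ENNReal.toReal_one]

/-- The set `Gauss₀(n)` of all `ψ_{X,Y}^γ` with `X`, `Y` real symmetric, `X > 0` (positive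
definiteness of a real matrix includes its symmetry) and `γ` real. -/
def Gauss₀ (n : ℕ) {ħ : ℝ} (hħ : 0 < ħ) : Set (L2 n) :=
  {ψ | ∃ (X Y : Matrix (Fin n) (Fin n) ℝ) (hX : X.PosDef) (_ : Y.IsSymm) (γ : ℝ),
    ψ = gauss hħ hX Y γ}

end Metaplectic

end

open MeasureTheory
open scoped FourierTransform SchwartzMap
noncomputable section
namespace Metaplectic

/-! Every operator involved is unitary and every `gauss` has norm one. Once an image is known to be
a constant times a Gaussian exponential, that constant is the positive normalization times a phase,
and every phase is some `i^γ`. So only the exponents need to be followed, never the branches of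
square roots (`exists_eq_gauss_of_ae_eq`).

On exponents, `opV` subtracts `P` from `Y` and `opM` acts by the congruence `A ↦ LᵀAL` on both
forms. For `opJ`, write `X = CᵀC` and `Y = Cᵀ diag(d) C`. In the coordinates `Cx` the Fourier
integral splits into one-dimensional Gaussian integrals, which replace `1 + i dⱼ` by its inverse `(1
- i dⱼ)/(1 + dⱼ²)`. The result again has the form "identity plus `i` times diagonal" in an explicit
dual frame, with `-d` in place of `d` (`exists_opJ_gauss`).

Closure induction also has to handle inverses, so the invariant is an equivalence, `PreservesGauss`:
each generator maps the set of Gaussians onto itself.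

For transitivity, `opV` removes the imaginary form, `opM` carries `X` to `X'`, and a second `opV`
installs `Y'`. -/

/-! ### Phases, and the Fourier transform on L² -/

theorem exists_I_cpow_eq {c : ℂ} (hc : ‖c‖ = 1) : ∃ γ : ℝ, Complex.I ^ (γ : ℂ) = c := by
  -- Since `log i = iπ/2`, this `γ` makes `γ log i = i arg c`.
  refine ⟨2 * c.arg / Real.pi, ?_⟩
  have hπ : (Real.pi : ℂ) ≠ 0 := by exact_mod_cast Real.pi_ne_zero
  rw [Complex.cpow_def_of_ne_zero Complex.I_ne_zero, Complex.log_I]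
  conv_rhs => rw [← Complex.norm_mul_exp_arg_mul_I c, hc]
  push_cast
  rw [one_mul]
  congr 1
  field_simp

/-- L² embeds injectively into tempered distributions, where the Fourier transform is defined by
duality. The identity is then `∫ û f = ∫ u f̂` for Schwartz `u`, valid because `f` is integrable. -/
theorem fourier_toLp {n : ℕ} {f : Conf n → ℂ} (hf : Integrable f volume) (hf2 : MemLp f 2 volume)
    (hg : MemLp (𝓕 f) 2 volume) :
    Lp.fourierTransformₗᵢ (Conf n) ℂ hf2.toLp = hg.toLp := by
  have hker := LinearMap.ker_eq_bot.1
    (Lp.ker_toTemperedDistributionCLM_eq_bot (F := ℂ) (μ := (volume : Measure (Conf n))) (p := 2))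
  apply hker
  change ((𝓕 (hf2.toLp) : Lp ℂ 2 (volume : Measure (Conf n))) : 𝓢'(Conf n, ℂ)) = _
  rw [← Lp.fourier_toTemperedDistribution_eq]
  ext u
  change _ = Lp.toTemperedDistribution hg.toLp u
  rw [TemperedDistribution.fourier_apply, Lp.toTemperedDistribution_apply,
    Lp.toTemperedDistribution_apply]
  have h1 : ∫ x, (𝓕 u) x • (hf2.toLp : Conf n → ℂ) x = ∫ x, (𝓕 u) x • f x := by
    refine integral_congr_ae ?_
    filter_upwards [hf2.coeFn_toLp] with x hx
    rw [hx]
  have h2 : ∫ x, u x • (hg.toLp : Conf n → ℂ) x = ∫ x, u x • (𝓕 f) x := by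
    refine integral_congr_ae ?_
    filter_upwards [hg.coeFn_toLp] with x hx
    rw [hx]
  rw [h1, h2]
  simpa using! VectorFourier.integral_fourierIntegral_smul_eq_flip (L := innerₗ (Conf n))
    Real.continuous_fourierChar continuous_inner u.integrable hf

/-! ### Quadratic forms and congruence -/

theorem quad_eq_dotProduct {n : ℕ} (A : Matrix (Fin n) (Fin n) ℝ) (x : Conf n) :
    quad A x = (A.mulVec x.ofLp) ⬝ᵥ x.ofLp := by
  simp [quad, PiLp.inner_apply, dotProduct, Matrix.toLpLin_apply, mul_comm]

theorem quad_transpose_mul_mul {n : ℕ} (L A : Matrix (Fin n) (Fin n) ℝ) (x : Conf n) :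
    quad (L.transpose * A * L) x = quad A (Matrix.toEuclideanLin L x) := by
  rw [quad_eq_dotProduct, quad_eq_dotProduct, Matrix.toLpLin_apply, ← Matrix.mulVec_mulVec,
    ← Matrix.mulVec_mulVec, Matrix.mulVec_transpose, ← Matrix.dotProduct_mulVec]

theorem quad_diagonal {n : ℕ} (d : Fin n → ℝ) (x : Conf n) :
    quad (Matrix.diagonal d) x = ∑ i, d i * x i ^ 2 := by
  rw [quad_eq_dotProduct, dotProduct]
  refine Finset.sum_congr rfl fun i _ => ?_
  rw [Matrix.mulVec_diagonal]
  ring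

theorem quad_add {n : ℕ} (A B : Matrix (Fin n) (Fin n) ℝ) (x : Conf n) :
    quad (A + B) x = quad A x + quad B x := by
  simp [quad_eq_dotProduct, Matrix.add_mulVec, add_dotProduct]

theorem posDef_transpose_mul_mul {n : ℕ} {L X : Matrix (Fin n) (Fin n) ℝ} (hX : X.PosDef)
    (hL : L.det ≠ 0) : (L.transpose * X * L).PosDef := by
  have h := hX.conjTranspose_mul_mul_same
    (B := L) (Matrix.mulVec_injective_iff_isUnit.2 ((Matrix.isUnit_iff_isUnit_det L).2 hL.isUnit))
  rwa [Matrix.conjTranspose_eq_transpose_of_trivial] at h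

theorem isSymm_transpose_mul_mul {n : ℕ} (L : Matrix (Fin n) (Fin n) ℝ)
    {Y : Matrix (Fin n) (Fin n) ℝ} (hY : Y.IsSymm) : (L.transpose * Y * L).IsSymm := by
  rw [Matrix.IsSymm, Matrix.transpose_mul, Matrix.transpose_mul, Matrix.transpose_transpose,
    hY.eq, Matrix.mul_assoc]

/-- A positive definite and a symmetric form can be diagonalized simultaneously. -/
theorem exists_simultaneous_diagonalization {n : ℕ} {X Y : Matrix (Fin n) (Fin n) ℝ}
    (hX : X.PosDef) (hY : Y.IsSymm) :
    ∃ (C : Matrix (Fin n) (Fin n) ℝ) (d : Fin n → ℝ), C.det ≠ 0 ∧ X = C.transpose * 1 * C ∧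
      Y = C.transpose * Matrix.diagonal d * C := by
  obtain ⟨B, hB⟩ : ∃ B : Matrix (Fin n) (Fin n) ℝ, X = B.conjTranspose * B := by
    open scoped MatrixOrder Matrix.Norms.L2Operator in
    exact CStarAlgebra.nonneg_iff_eq_star_mul_self.mp hX.posSemidef.nonneg
  rw [Matrix.conjTranspose_eq_transpose_of_trivial] at hB
  have hBdet : B.det ≠ 0 := fun h => by
    have := hX.det_pos
    rw [hB, Matrix.det_mul, h] at this
    simp at this
  have hBu : IsUnit B.det := hBdet.isUnit
  have hY1 : ((B⁻¹).transpose * Y * B⁻¹).IsHermitian := by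
    rw [Matrix.IsHermitian, Matrix.conjTranspose_eq_transpose_of_trivial]
    exact isSymm_transpose_mul_mul _ hY
  set U : Matrix (Fin n) (Fin n) ℝ := hY1.eigenvectorUnitary.1
  have hUU : U * U.transpose = 1 := by
    have := Unitary.coe_mul_star_self hY1.eigenvectorUnitary
    rwa [Unitary.coe_star, Matrix.star_eq_conjTranspose, Matrix.conjTranspose_eq_transpose_of_trivial] at this
  have hspec : (B⁻¹).transpose * Y * B⁻¹
      = U * Matrix.diagonal hY1.eigenvalues * U.transpose := by
    have := hY1.spectral_theorem
    rw [Unitary.conjStarAlgAut_apply, Matrix.star_eq_conjTranspose,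
      Matrix.conjTranspose_eq_transpose_of_trivial] at this
    exact this
  -- `B` turns `X` into the identity form; the orthogonal `U` diagonalizes what `Y` becomes and
  -- leaves the identity fixed.
  refine ⟨U.transpose * B, hY1.eigenvalues, ?_, ?_, ?_⟩
  · have : U.det * U.transpose.det = 1 := by rw [← Matrix.det_mul, hUU, Matrix.det_one]
    rw [Matrix.det_mul]
    exact mul_ne_zero (right_ne_zero_of_mul_eq_one this) hBdet
  · rw [hB, Matrix.transpose_mul, Matrix.transpose_transpose, Matrix.mul_one, Matrix.mul_assoc,
      ← Matrix.mul_assoc U, hUU, Matrix.one_mul]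
  · have h2 : B.transpose * ((B⁻¹).transpose * Y * B⁻¹) * B = Y := by
      rw [Matrix.mul_assoc, Matrix.mul_assoc, Matrix.nonsing_inv_mul B hBu, Matrix.mul_one,
        ← Matrix.mul_assoc, ← Matrix.transpose_mul, Matrix.nonsing_inv_mul B hBu,
        Matrix.transpose_one, Matrix.one_mul]
    conv_lhs => rw [← h2, hspec]
    simp only [Matrix.transpose_mul, Matrix.transpose_transpose, Matrix.mul_assoc]

/-! ### Gaussians up to phase, chirps and dilations -/

theorem gauss_coeFn {n : ℕ} {ħ : ℝ} (hħ : 0 < ħ) {X : Matrix (Fin n) (Fin n) ℝ} (hX : X.PosDef)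
    (Y : Matrix (Fin n) (Fin n) ℝ) (γ : ℝ) :
    (gauss hħ hX Y γ : Conf n → ℂ) =ᵐ[volume] gaussFun ħ X Y γ :=
  (gaussFun_aux hħ hX Y γ).1.coeFn_toLp

theorem gauss_add {n : ℕ} {ħ : ℝ} (hħ : 0 < ħ) {X : Matrix (Fin n) (Fin n) ℝ} (hX : X.PosDef)
    (Y : Matrix (Fin n) (Fin n) ℝ) (γ δ : ℝ) :
    gauss hħ hX Y (γ + δ) = Complex.I ^ (γ : ℂ) • gauss hħ hX Y δ := by
  refine Lp.ext ?_
  filter_upwards [gauss_coeFn hħ hX Y (γ + δ), gauss_coeFn hħ hX Y δ,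
    Lp.coeFn_smul (Complex.I ^ (γ : ℂ)) (gauss hħ hX Y δ)] with x h1 h2 h3
  rw [h1, h3, Pi.smul_apply, h2, gaussFun, gaussFun, Complex.ofReal_add,
    Complex.cpow_add _ _ Complex.I_ne_zero, smul_eq_mul]
  ring

/-- A normalized multiple of a Gaussian exponential is a generalized Gaussian. -/
theorem exists_eq_gauss_of_ae_eq {n : ℕ} {ħ : ℝ} (hħ : 0 < ħ) {X : Matrix (Fin n) (Fin n) ℝ}
    (hX : X.PosDef) (Y : Matrix (Fin n) (Fin n) ℝ) {φ : L2 n} (hφ : ‖φ‖ = 1) (c : ℂ)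
    (h : (φ : Conf n → ℂ) =ᵐ[volume] fun x => c * Complex.exp (-(1 / (2 * (ħ : ℂ))) *
      ((quad X x : ℂ) + Complex.I * (quad Y x : ℂ)))) :
    ∃ γ : ℝ, φ = gauss hħ hX Y γ := by
  set K : ℝ := (1 / (Real.pi * ħ)) ^ ((n : ℝ) / 4) * X.det ^ ((1 : ℝ) / 4) with hK
  have hK0 : (K : ℂ) ≠ 0 := by
    have := hX.det_pos
    have : 0 < K := by positivity
    exact_mod_cast this.ne'
  have h1 : φ = (c / K) • gauss hħ hX Y 0 := by
    refine Lp.ext ?_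
    filter_upwards [h, gauss_coeFn hħ hX Y 0, Lp.coeFn_smul (c / (K : ℂ)) (gauss hħ hX Y 0)]
      with x h1 h2 h3
    rw [h1, h3, Pi.smul_apply, h2, gaussFun, ← hK, Complex.ofReal_zero, Complex.cpow_zero,
      smul_eq_mul]
    field_simp
  -- Both `φ` and the Gaussian have norm one, which forces `|c / K| = 1`.
  obtain ⟨γ, hγ⟩ := exists_I_cpow_eq (c := c / K) (by
    rw [h1, norm_smul, norm_gauss, mul_one] at hφ
    exact hφ)
  exact ⟨γ, by rw [h1, ← hγ, ← gauss_add, add_zero]⟩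

theorem exists_opV_gauss {n : ℕ} {ħ : ℝ} (hħ : 0 < ħ) {X : Matrix (Fin n) (Fin n) ℝ}
    (hX : X.PosDef) (P Y : Matrix (Fin n) (Fin n) ℝ) :
    ∃ γ : ℝ, opV ħ P (gauss hħ hX (Y + P) 0) = gauss hħ hX Y γ := by
  refine exists_eq_gauss_of_ae_eq hħ hX Y (by rw [LinearIsometryEquiv.norm_map, norm_gauss])
    (((1 / (Real.pi * ħ)) ^ ((n : ℝ) / 4) * X.det ^ ((1 : ℝ) / 4) : ℝ) : ℂ) ?_
  filter_upwards [opV_coeFn ħ P (gauss hħ hX (Y + P) 0), gauss_coeFn hħ hX (Y + P) 0]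
    with x h1 h2
  rw [h1, h2, gaussFun, Complex.ofReal_zero, Complex.cpow_zero, one_mul, mul_left_comm,
    ← Complex.exp_add, quad_add]
  congr 2
  push_cast
  ring

theorem exists_opM_gauss {n : ℕ} {ħ : ℝ} (hħ : 0 < ħ) {X : Matrix (Fin n) (Fin n) ℝ}
    (hX : X.PosDef) (Y : Matrix (Fin n) (Fin n) ℝ) (L : Matrix (Fin n) (Fin n) ℝ)
    (hL : L.det ≠ 0) (m : ℤ) :
    ∃ γ : ℝ, opM L hL m (gauss hħ hX Y 0) =
      gauss hħ (posDef_transpose_mul_mul hX hL) (L.transpose * Y * L) γ := by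
  refine exists_eq_gauss_of_ae_eq hħ _ _ (by rw [LinearIsometryEquiv.norm_map, norm_gauss])
    (Complex.I ^ m * (√|L.det| : ℂ) *
      (((1 / (Real.pi * ħ)) ^ ((n : ℝ) / 4) * X.det ^ ((1 : ℝ) / 4) : ℝ) : ℂ)) ?_
  filter_upwards [opM_coeFn L hL m (gauss hħ hX Y 0),
    (quasi_linearEquiv (linEquiv L hL)).ae (gauss_coeFn hħ hX Y 0)] with x h1 h2
  have hLx : linEquiv L hL x = Matrix.toEuclideanLin L x := rfl
  rw [hLx] at h2
  rw [h1, h2, gaussFun, Complex.ofReal_zero, Complex.cpow_zero, one_mul,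
    quad_transpose_mul_mul, quad_transpose_mul_mul, mul_assoc _ _ (Complex.exp _)]


/-! ### The Fourier transform of a Gaussian -/

theorem integral_comp_linearEquiv {n : ℕ} (A : Conf n ≃ₗ[ℝ] Conf n) (F : Conf n → ℂ) :
    ∫ x, F (A x) = |(LinearMap.det (A : Conf n →ₗ[ℝ] Conf n))⁻¹| • ∫ y, F y := by
  have hA : MeasurableEmbedding A :=
    A.toContinuousLinearEquiv.toHomeomorph.measurableEmbedding
  rw [← hA.integral_map, map_linearEquiv, integral_smul_measure,
    ENNReal.toReal_ofReal (abs_nonneg _)]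

theorem integral_cexp_neg_sum_mul_sq_add {n : ℕ} {b : Fin n → ℂ} (hb : ∀ i, 0 < (b i).re)
    (c : Fin n → ℂ) :
    ∫ y : Conf n, Complex.exp (-∑ i, b i * (y i : ℂ) ^ 2 + ∑ i, c i * (y i : ℂ))
      = ∏ i, (Real.pi / b i) ^ (1 / 2 : ℂ) * Complex.exp (c i ^ 2 / (4 * b i)) := by
  rw [← (PiLp.volume_preserving_toLp (Fin n)).integral_comp
    (MeasurableEquiv.toLp 2 _).measurableEmbedding]
  exact GaussianFourier.integral_cexp_neg_sum_mul_add hb c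

theorem inner_toEuclideanLin_transpose_inv {n : ℕ} {C : Matrix (Fin n) (Fin n) ℝ}
    (hC : C.det ≠ 0) (x ξ : Conf n) :
    inner ℝ (Matrix.toEuclideanLin C x) (Matrix.toEuclideanLin C⁻¹.transpose ξ) =
      inner ℝ x ξ := by
  rw [← Matrix.conjTranspose_eq_transpose_of_trivial,
    Matrix.toEuclideanLin_conjTranspose_eq_adjoint, LinearMap.adjoint_inner_right,
    ← LinearMap.comp_apply, ← Matrix.toLpLin_mul_same, Matrix.nonsing_inv_mul C hC.isUnit,
    Matrix.toLpLin_one, LinearMap.id_apply]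

/-- The matrix that diagonalizes the Fourier transform of the Gaussian whose forms are
diagonalized by `C`, with diagonal entries `1` and `dᵢ`. -/
def dualFrame {n : ℕ} (C : Matrix (Fin n) (Fin n) ℝ) (d : Fin n → ℝ) :
    Matrix (Fin n) (Fin n) ℝ :=
  Matrix.diagonal (fun i => (√(1 + d i ^ 2))⁻¹) * C⁻¹.transpose

theorem det_dualFrame_ne_zero {n : ℕ} {C : Matrix (Fin n) (Fin n) ℝ} (hC : C.det ≠ 0)
    (d : Fin n → ℝ) : (dualFrame C d).det ≠ 0 := by
  rw [dualFrame, Matrix.det_mul, Matrix.det_diagonal, Matrix.det_transpose]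
  refine mul_ne_zero (Finset.prod_ne_zero_iff.2 fun i _ => ?_) ?_
  · positivity
  · exact (Matrix.isUnit_nonsing_inv_det C hC.isUnit).ne_zero

/-- The scaling `√(1 + d²)` is even in `d`, so the two scalings cancel, as do the two inverse
transposes. This exhibits every frame as a dual frame, hence gives surjectivity of `opJ` on
Gaussians. -/
theorem dualFrame_dualFrame {n : ℕ} {C : Matrix (Fin n) (Fin n) ℝ} (hC : C.det ≠ 0)
    (d : Fin n → ℝ) : dualFrame (dualFrame C (-d)) d = C := by
  have h : ∀ i, √(1 + d i ^ 2) ≠ 0 := fun i => by positivity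
  have hinv : (dualFrame C (-d))⁻¹ =
      C.transpose * Matrix.diagonal (fun i => √(1 + d i ^ 2)) := by
    refine Matrix.inv_eq_right_inv ?_
    have : C⁻¹.transpose * C.transpose = 1 := by
      rw [← Matrix.transpose_mul, Matrix.mul_nonsing_inv C hC.isUnit, Matrix.transpose_one]
    rw [dualFrame, Matrix.mul_assoc, ← Matrix.mul_assoc C⁻¹.transpose, this, Matrix.one_mul,
      Matrix.diagonal_mul_diagonal]
    simp [h]
  rw [dualFrame, hinv, Matrix.transpose_mul, Matrix.transpose_transpose,
    Matrix.diagonal_transpose, ← Matrix.mul_assoc, Matrix.diagonal_mul_diagonal]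
  simp [h]

theorem quad_one_add_I_mul_quad_diagonal {n : ℕ} (C : Matrix (Fin n) (Fin n) ℝ)
    (d : Fin n → ℝ) (x : Conf n) :
    (quad (C.transpose * 1 * C) x : ℂ) +
        Complex.I * (quad (C.transpose * Matrix.diagonal d * C) x : ℂ) =
      ∑ i, (1 + Complex.I * d i) * (Matrix.toEuclideanLin C x i : ℂ) ^ 2 := by
  rw [quad_transpose_mul_mul, quad_transpose_mul_mul, ← Matrix.diagonal_one, quad_diagonal,
    quad_diagonal]
  push_cast
  rw [Finset.mul_sum, ← Finset.sum_add_distrib]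
  refine Finset.sum_congr rfl fun i _ => ?_
  ring

/-- The scaling in the dual frame is exactly what makes `(1 - i d)/(1 + d²) = 1/(1 + i d)` appear on
each coordinate. -/
theorem quad_dualFrame {n : ℕ} (C : Matrix (Fin n) (Fin n) ℝ)
    (d : Fin n → ℝ) (ξ : Conf n) :
    (quad ((dualFrame C d).transpose * 1 * dualFrame C d) ξ : ℂ) + Complex.I *
        (quad ((dualFrame C d).transpose * Matrix.diagonal (-d) * dualFrame C d) ξ : ℂ) =
      ∑ i, (Matrix.toEuclideanLin C⁻¹.transpose ξ i : ℂ) ^ 2 / (1 + Complex.I * d i) := by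
  rw [quad_one_add_I_mul_quad_diagonal]
  refine Finset.sum_congr rfl fun i _ => ?_
  have h1 : Matrix.toEuclideanLin (dualFrame C d) ξ i =
      (√(1 + d i ^ 2))⁻¹ * Matrix.toEuclideanLin C⁻¹.transpose ξ i := by
    simp only [dualFrame, Matrix.toLpLin_apply, ← Matrix.mulVec_mulVec, Matrix.mulVec_diagonal]
  have hs : ((√(1 + d i ^ 2) : ℝ) : ℂ) ^ 2 = (1 + Complex.I * d i) * (1 - Complex.I * d i) := by
    rw [← Complex.ofReal_pow, Real.sq_sqrt (by positivity)]
    push_cast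
    linear_combination (d i : ℂ) ^ 2 * Complex.I_sq
  have hs0 : ((√(1 + d i ^ 2) : ℝ) : ℂ) ^ 2 ≠ 0 := by
    have : √(1 + d i ^ 2) ≠ 0 := by positivity
    exact pow_ne_zero 2 (by exact_mod_cast this)
  have hm := hs0
  rw [hs] at hm
  have h2 := left_ne_zero_of_mul hm
  have h3 := right_ne_zero_of_mul hm
  rw [h1]
  push_cast
  rw [mul_pow, inv_pow, hs, Pi.neg_apply]
  push_cast
  rw [mul_neg, ← sub_eq_add_neg]
  field_simp

/-- The Fourier transform of a Gaussian in a frame diagonalizing its forms. -/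
theorem exists_fourier_gaussFun {n : ℕ} {ħ : ℝ} (hħ : 0 < ħ) {C : Matrix (Fin n) (Fin n) ℝ}
    (hC : C.det ≠ 0) (d : Fin n → ℝ) :
    ∃ c : ℂ, c ≠ 0 ∧ ∀ ξ, 𝓕 (gaussFun ħ (C.transpose * 1 * C)
        (C.transpose * Matrix.diagonal d * C) 0) ξ =
      c * Complex.exp (-(2 * (Real.pi : ℂ) ^ 2 * ħ) *
        ((quad ((dualFrame C d).transpose * 1 * dualFrame C d) ξ : ℂ) + Complex.I *
          (quad ((dualFrame C d).transpose * Matrix.diagonal (-d) * dualFrame C d) ξ : ℂ))) := by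
  have hħ' : (ħ : ℂ) ≠ 0 := by exact_mod_cast hħ.ne'
  have hπ : (Real.pi : ℂ) ≠ 0 := by exact_mod_cast Real.pi_ne_zero
  set X := C.transpose * 1 * C
  have hX : X.PosDef := posDef_transpose_mul_mul Matrix.PosDef.one hC
  set K : ℝ := (1 / (Real.pi * ħ)) ^ ((n : ℝ) / 4) * X.det ^ ((1 : ℝ) / 4) with hK
  have hK0 : (K : ℂ) ≠ 0 := by
    have := hX.det_pos
    have : 0 < K := by positivity
    exact_mod_cast this.ne'
  set b : Fin n → ℂ := fun i => (1 + Complex.I * d i) / (2 * ħ) with hbdef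
  have hd : ∀ i, 1 + Complex.I * (d i : ℂ) ≠ 0 := fun i h => by
    have := congrArg Complex.re h
    simp at this
  have hb : ∀ i, 0 < (b i).re := fun i => by
    have : b i = ((1 / (2 * ħ) : ℝ) : ℂ) * (1 + Complex.I * d i) := by
      simp only [hbdef]; push_cast; ring
    rw [this, Complex.re_ofReal_mul]
    simp [hħ]
  have hb0 : ∀ i, b i ≠ 0 := fun i h => by
    have := hb i
    rw [h] at this
    simp at this
  -- Normalization, Jacobian of `y = Cx`, and one Gaussian integral per coordinate.
  refine ⟨K * ((|C.det⁻¹| : ℝ) : ℂ) * ∏ i, (Real.pi / b i) ^ (1 / 2 : ℂ), ?_, fun ξ => ?_⟩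
  · refine mul_ne_zero (mul_ne_zero hK0 ?_) (Finset.prod_ne_zero_iff.2 fun i _ => ?_)
    · have : |C.det⁻¹| ≠ 0 := by positivity
      exact_mod_cast this
    · rw [Complex.cpow_def_of_ne_zero (div_ne_zero hπ (hb0 i))]
      exact Complex.exp_ne_zero _
  · set η := Matrix.toEuclideanLin C⁻¹.transpose ξ with hη
    set c : Fin n → ℂ := fun i => -(2 * Real.pi * Complex.I) * η i with hc
    set F : Conf n → ℂ := fun y => (K : ℂ) * Complex.exp
      (-∑ i, b i * (y i : ℂ) ^ 2 + ∑ i, c i * (y i : ℂ)) with hF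
    -- With `η = C⁻ᵀξ`, the pairing `x · ξ` becomes `Cx · η`, so the integrand is a function of `Cx`
    -- with diagonal exponent.
    have hint : ∀ x : Conf n, Complex.exp (((-2 * Real.pi * inner ℝ x ξ : ℝ) : ℂ) * Complex.I) •
        gaussFun ħ X (C.transpose * Matrix.diagonal d * C) 0 x =
        F (linEquiv C hC x) := by
      intro x
      have hCx : linEquiv C hC x = Matrix.toEuclideanLin C x := rfl
      rw [hCx, hF, gaussFun, quad_one_add_I_mul_quad_diagonal, ← hK, Complex.ofReal_zero,
        Complex.cpow_zero, one_mul, smul_eq_mul, mul_left_comm, ← Complex.exp_add]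
      congr 2
      rw [← inner_toEuclideanLin_transpose_inv hC, ← hη, add_comm, PiLp.inner_apply,
        Finset.mul_sum, ← Finset.sum_neg_distrib]
      push_cast
      rw [Finset.mul_sum, Finset.sum_mul]
      congr 1
      · refine Finset.sum_congr rfl fun i _ => ?_
        simp only [hbdef]
        field_simp
      · refine Finset.sum_congr rfl fun i _ => ?_
        simp only [hc, RCLike.inner_apply, conj_trivial]
        push_cast
        ring
    rw [Real.fourier_eq']
    simp_rw [hint]
    rw [integral_comp_linearEquiv, det_linEquiv, hF, integral_const_mul,
      integral_cexp_neg_sum_mul_sq_add hb, Finset.prod_mul_distrib, ← Complex.exp_sum,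
      quad_dualFrame, Finset.mul_sum, Complex.real_smul]
    have hsum : ∑ i, c i ^ 2 / (4 * b i) =
        ∑ i, -(2 * (Real.pi : ℂ) ^ 2 * ħ) * ((η i : ℂ) ^ 2 / (1 + Complex.I * d i)) := by
      refine Finset.sum_congr rfl fun i _ => ?_
      have := hd i
      simp only [hc, hbdef]
      field_simp
      rw [Complex.I_sq]
      ring
    rw [hsum]
    ring

theorem quad_smul {n : ℕ} (A : Matrix (Fin n) (Fin n) ℝ) (r : ℝ) (x : Conf n) :
    quad A (r • x) = r ^ 2 * quad A x := by
  rw [quad, quad, map_smul, inner_smul_left, inner_smul_right, conj_trivial]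
  ring

/-- A non-integrable function has integral `0` by convention, while the Fourier formula at `ξ = 0`
gives a nonzero integral. -/
theorem integrable_gaussFun {n : ℕ} {ħ : ℝ} (hħ : 0 < ħ) {C : Matrix (Fin n) (Fin n) ℝ}
    (hC : C.det ≠ 0) (d : Fin n → ℝ) :
    Integrable (gaussFun ħ (C.transpose * 1 * C) (C.transpose * Matrix.diagonal d * C) 0)
      volume := by
  obtain ⟨c, hc, h⟩ := exists_fourier_gaussFun hħ hC d
  refine not_imp_comm.1 integral_undef fun h0 => ?_
  have := h 0
  rw [Real.fourier_eq'] at this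
  simp only [inner_zero_right, mul_zero, Complex.ofReal_zero, zero_mul, Complex.exp_zero,
    one_smul] at this
  rw [h0] at this
  exact mul_ne_zero hc (Complex.exp_ne_zero _) this.symm

theorem exists_opJ_gauss {n : ℕ} {ħ : ℝ} (hħ : 0 < ħ) {C : Matrix (Fin n) (Fin n) ℝ}
    (hC : C.det ≠ 0) (d : Fin n → ℝ) :
    ∃ γ : ℝ, opJ n hħ (gauss hħ (posDef_transpose_mul_mul Matrix.PosDef.one hC)
        (C.transpose * Matrix.diagonal d * C) 0) =
      gauss hħ (posDef_transpose_mul_mul Matrix.PosDef.one (det_dualFrame_ne_zero hC d))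
        ((dualFrame C d).transpose * Matrix.diagonal (-d) * dualFrame C d) γ := by
  have hħ' : (ħ : ℂ) ≠ 0 := by exact_mod_cast hħ.ne'
  have hπ : (Real.pi : ℂ) ≠ 0 := by exact_mod_cast Real.pi_ne_zero
  obtain ⟨c, -, h⟩ := exists_fourier_gaussFun hħ hC d
  set X' := (dualFrame C d).transpose * 1 * dualFrame C d
  have hX' : X'.PosDef := posDef_transpose_mul_mul Matrix.PosDef.one (det_dualFrame_ne_zero hC d)
  set Y' := (dualFrame C d).transpose * Matrix.diagonal (-d) * dualFrame C d
  set f := gaussFun ħ (C.transpose * 1 * C) (C.transpose * Matrix.diagonal d * C) 0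
  have hk : 0 < 1 / (4 * Real.pi ^ 2 * ħ) := by positivity
  -- Chosen so that `1/(2k) = 2π²ħ`: the Fourier transform is a multiple of a Gaussian with `k` in
  -- the role of `ħ`, hence lies in L².
  set k := 1 / (4 * Real.pi ^ 2 * ħ) with hkdef
  set K : ℝ := (1 / (Real.pi * k)) ^ ((n : ℝ) / 4) * X'.det ^ ((1 : ℝ) / 4) with hK
  have hK0 : (K : ℂ) ≠ 0 := by
    have := hX'.det_pos
    have : 0 < K := by positivity
    exact_mod_cast this.ne'
  have hg : MemLp (𝓕 f) 2 volume := by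
    have hfun : 𝓕 f = fun ξ => c / K * gaussFun k X' Y' 0 ξ := by
      funext ξ
      rw [h, gaussFun, ← hK, Complex.ofReal_zero, Complex.cpow_zero, one_mul, ← mul_assoc,
        div_mul_cancel₀ _ hK0]
      congr 3
      rw [hkdef]
      push_cast
      field_simp
      norm_num
    rw [hfun]
    exact (gaussFun_aux hk hX' Y' 0).1.const_mul _
  refine exists_eq_gauss_of_ae_eq hħ hX' Y' (by rw [LinearIsometryEquiv.norm_map, norm_gauss])
    (constJ n ħ * c) ?_
  rw [opJ, LinearIsometryEquiv.trans_apply, gauss,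
    fourier_toLp (integrable_gaussFun hħ hC d) _ hg]
  filter_upwards [weightedEquiv_coeFn (scaleEquiv n hħ) (fun _ => constJ n ħ)
    continuous_const (fun _ => norm_constJ n hħ) hg.toLp,
    (quasi_linearEquiv (scaleEquiv n hħ)).ae hg.coeFn_toLp] with x h1 h2
  have hs : scaleEquiv n hħ x = (2 * Real.pi * ħ)⁻¹ • x := rfl
  rw [h1, h2, h, hs, quad_smul, quad_smul, mul_assoc (constJ n ħ) c]
  -- The rescaling by `(2πħ)⁻¹` turns the factor `2π²ħ` back into `1/(2ħ)`.
  congr 3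
  push_cast
  field_simp

/-! ### Invariance under the group, and transitivity -/

theorem gauss_congr {n : ℕ} {ħ : ℝ} (hħ : 0 < ħ) {X X' Y Y' : Matrix (Fin n) (Fin n) ℝ}
    (hX : X.PosDef) (hX' : X'.PosDef) (hXX' : X = X') (hYY' : Y = Y') (γ : ℝ) :
    gauss hħ hX Y γ = gauss hħ hX' Y' γ := by
  subst hXX' hYY'
  rfl

theorem map_gauss_of_map_gauss {n : ℕ} {ħ : ℝ} {hħ : 0 < ħ} {S : L2 n ≃ₗᵢ[ℂ] L2 n}
    {X X' Y Y' : Matrix (Fin n) (Fin n) ℝ} {hX : X.PosDef} {hX' : X'.PosDef}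
    (h : ∃ δ : ℝ, S (gauss hħ hX Y 0) = gauss hħ hX' Y' δ) (γ : ℝ) :
    ∃ δ : ℝ, S (gauss hħ hX Y γ) = gauss hħ hX' Y' δ := by
  obtain ⟨δ, hδ⟩ := h
  exact ⟨γ + δ, by rw [gauss_add, ← hδ, ← map_smul, ← gauss_add, add_zero]⟩

theorem exists_map_eq_gauss {n : ℕ} {ħ : ℝ} {hħ : 0 < ħ} {S : L2 n ≃ₗᵢ[ℂ] L2 n}
    {X X' Y Y' : Matrix (Fin n) (Fin n) ℝ} {hX : X.PosDef} {hX' : X'.PosDef}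
    (h : ∃ δ : ℝ, S (gauss hħ hX Y 0) = gauss hħ hX' Y' δ) (γ : ℝ) :
    ∃ δ : ℝ, S (gauss hħ hX Y δ) = gauss hħ hX' Y' γ := by
  obtain ⟨δ, hδ⟩ := h
  refine ⟨γ - δ, ?_⟩
  rw [← add_zero (γ - δ), gauss_add, map_smul, hδ, ← gauss_add, sub_add_cancel]

/-- The operators that preserve the set of centered Gaussians in both directions. -/
def PreservesGauss {n : ℕ} {ħ : ℝ} (hħ : 0 < ħ) (S : L2 n ≃ₗᵢ[ℂ] L2 n) : Prop :=
  ∀ ψ, S ψ ∈ Gauss₀ n hħ ↔ ψ ∈ Gauss₀ n hħ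

theorem preservesGauss_of_maps {n : ℕ} {ħ : ℝ} {hħ : 0 < ħ} {S : L2 n ≃ₗᵢ[ℂ] L2 n}
    (h1 : ∀ ψ ∈ Gauss₀ n hħ, S ψ ∈ Gauss₀ n hħ)
    (h2 : ∀ φ ∈ Gauss₀ n hħ, ∃ ψ ∈ Gauss₀ n hħ, S ψ = φ) : PreservesGauss hħ S := by
  refine fun ψ => ⟨fun h => ?_, h1 ψ⟩
  obtain ⟨φ, hφ, hS⟩ := h2 _ h
  rwa [← S.injective hS]

theorem preservesGauss_opV {n : ℕ} {ħ : ℝ} (hħ : 0 < ħ) {P : Matrix (Fin n) (Fin n) ℝ}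
    (hP : P.IsSymm) : PreservesGauss hħ (opV ħ P) := by
  refine preservesGauss_of_maps ?_ ?_
  · rintro _ ⟨X, Y, hX, hY, γ, rfl⟩
    have h := exists_opV_gauss hħ hX P (Y - P)
    rw [sub_add_cancel] at h
    obtain ⟨δ, hδ⟩ := map_gauss_of_map_gauss h γ
    exact ⟨X, Y - P, hX, hY.sub hP, δ, hδ⟩
  · rintro _ ⟨X, Y, hX, hY, γ, rfl⟩
    obtain ⟨δ, hδ⟩ := exists_map_eq_gauss (exists_opV_gauss hħ hX P Y) γ
    exact ⟨_, ⟨X, Y + P, hX, hY.add hP, δ, rfl⟩, hδ⟩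

theorem preservesGauss_opM {n : ℕ} {ħ : ℝ} (hħ : 0 < ħ) (L : Matrix (Fin n) (Fin n) ℝ)
    (hL : L.det ≠ 0) (m : ℤ) : PreservesGauss hħ (opM L hL m) := by
  refine preservesGauss_of_maps ?_ ?_
  · rintro _ ⟨X, Y, hX, hY, γ, rfl⟩
    obtain ⟨δ, hδ⟩ := map_gauss_of_map_gauss (exists_opM_gauss hħ hX Y L hL m) γ
    exact ⟨_, _, _, isSymm_transpose_mul_mul L hY, δ, hδ⟩
  · rintro _ ⟨X, Y, hX, hY, γ, rfl⟩
    have hL' : L⁻¹.det ≠ 0 := (Matrix.isUnit_nonsing_inv_det L hL.isUnit).ne_zero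
    have hcancel : ∀ A : Matrix (Fin n) (Fin n) ℝ,
        A = L.transpose * (L⁻¹.transpose * A * L⁻¹) * L := fun A => by
      rw [Matrix.mul_assoc, Matrix.mul_assoc, Matrix.nonsing_inv_mul L hL.isUnit, Matrix.mul_one,
        ← Matrix.mul_assoc, ← Matrix.transpose_mul, Matrix.nonsing_inv_mul L hL.isUnit,
        Matrix.transpose_one, Matrix.one_mul]
    have hX1 := posDef_transpose_mul_mul hX hL'
    obtain ⟨δ, hδ⟩ := exists_map_eq_gauss
      (exists_opM_gauss hħ hX1 (L⁻¹.transpose * Y * L⁻¹) L hL m) γ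
    refine ⟨_, ⟨_, _, hX1, isSymm_transpose_mul_mul _ hY, δ, rfl⟩, hδ.trans ?_⟩
    exact (gauss_congr hħ _ _ (hcancel X) (hcancel Y) γ).symm

theorem preservesGauss_opJ {n : ℕ} {ħ : ℝ} (hħ : 0 < ħ) : PreservesGauss hħ (opJ n hħ) := by
  refine preservesGauss_of_maps ?_ ?_
  · rintro _ ⟨X, Y, hX, hY, γ, rfl⟩
    obtain ⟨C, d, hC, rfl, rfl⟩ := exists_simultaneous_diagonalization hX hY
    obtain ⟨δ, hδ⟩ := map_gauss_of_map_gauss (exists_opJ_gauss hħ hC d) γ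
    exact ⟨_, _, _, isSymm_transpose_mul_mul _ (Matrix.isSymm_diagonal _), δ, hδ⟩
  · rintro _ ⟨X, Y, hX, hY, γ, rfl⟩
    obtain ⟨C, d, hC, rfl, rfl⟩ := exists_simultaneous_diagonalization hX hY
    -- The source frame is chosen so that its dual with respect to `-d` is `C`; the sign flip of
    -- `opJ` then returns `d`.
    obtain ⟨δ, hδ⟩ := exists_map_eq_gauss
      (exists_opJ_gauss hħ (det_dualFrame_ne_zero hC (-(-d))) (-d)) γ
    refine ⟨_, ⟨_, _, _, isSymm_transpose_mul_mul _ (Matrix.isSymm_diagonal _), δ, rfl⟩,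
      hδ.trans ?_⟩
    refine gauss_congr hħ _ _ ?_ ?_ γ
    · rw [dualFrame_dualFrame hC]
    · rw [dualFrame_dualFrame hC, neg_neg]

theorem preservesGauss_of_mem_Mp {n : ℕ} {ħ : ℝ} {hħ : 0 < ħ} {S : L2 n ≃ₗᵢ[ℂ] L2 n}
    (hS : S ∈ Mp n hħ) : PreservesGauss hħ S := by
  induction hS using Subgroup.closure_induction with
  | mem S hS =>
    rcases hS with (⟨P, hP, rfl⟩ | ⟨L, hL, m, -, rfl⟩) | rfl
    · exact preservesGauss_opV hħ hP
    · exact preservesGauss_opM hħ L hL m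
    · exact preservesGauss_opJ hħ
  | one => exact fun ψ => Iff.rfl
  | mul S T _ _ hS hT => exact fun ψ => (hS (T ψ)).trans (hT ψ)
  | inv S _ hS =>
    intro ψ
    have h := hS (S⁻¹ ψ)
    rw [show S (S⁻¹ ψ) = ψ from S.apply_symm_apply ψ] at h
    exact h.symm

theorem exists_mem_Mp_map_gauss {n : ℕ} {ħ : ℝ} (hħ : 0 < ħ)
    {X Y X' Y' : Matrix (Fin n) (Fin n) ℝ} (hX : X.PosDef) (hX' : X'.PosDef) (hY : Y.IsSymm)
    (hY' : Y'.IsSymm) :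
    ∃ S ∈ Mp n hħ, ∃ γ : ℝ, S (gauss hħ hX Y 0) = gauss hħ hX' Y' γ := by
  obtain ⟨B, -, hB, rfl, -⟩ := exists_simultaneous_diagonalization hX hY
  obtain ⟨C, -, hC, rfl, -⟩ := exists_simultaneous_diagonalization hX' hY'
  -- With `X = BᵀB` and `X' = CᵀC`, congruence by `B⁻¹C` takes `X` to `X'`.
  have hL : (B⁻¹ * C).det ≠ 0 := by
    rw [Matrix.det_mul]
    exact mul_ne_zero (Matrix.isUnit_nonsing_inv_det B hB.isUnit).ne_zero hC
  obtain ⟨m, hm⟩ : ∃ m : ℤ, Even m ↔ 0 < (B⁻¹ * C).det := by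
    by_cases h : 0 < (B⁻¹ * C).det
    · exact ⟨0, iff_of_true (by simp) h⟩
    · exact ⟨1, iff_of_false (by simp) h⟩
  have hXX' : (B⁻¹ * C).transpose * (B.transpose * 1 * B) * (B⁻¹ * C) = C.transpose * 1 * C := by
    have h1 : B * (B⁻¹ * C) = C := by
      rw [← Matrix.mul_assoc, Matrix.mul_nonsing_inv B hB.isUnit, Matrix.one_mul]
    rw [Matrix.mul_assoc, Matrix.mul_assoc _ B, h1, ← Matrix.mul_assoc, ← Matrix.mul_assoc,
      ← Matrix.transpose_mul, h1]
  obtain ⟨γ₁, h1⟩ := exists_opV_gauss hħ hX Y 0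
  rw [zero_add] at h1
  obtain ⟨γ₂, h2⟩ := map_gauss_of_map_gauss (exists_opM_gauss hħ hX 0 (B⁻¹ * C) hL m) γ₁
  rw [gauss_congr hħ _ hX' hXX' (Y' := 0) (by simp)] at h2
  have h3 := exists_opV_gauss hħ hX' (-Y') Y'
  rw [add_neg_cancel] at h3
  obtain ⟨γ₃, h3⟩ := map_gauss_of_map_gauss h3 γ₂
  refine ⟨opV ħ (-Y') * (opM (B⁻¹ * C) hL m * opV ħ Y), ?_, γ₃, ?_⟩
  · refine mul_mem (Subgroup.subset_closure ?_)
      (mul_mem (Subgroup.subset_closure ?_) (Subgroup.subset_closure ?_))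
    · exact Or.inl (Or.inl ⟨_, hY'.neg, rfl⟩)
    · exact Or.inl (Or.inr ⟨_, hL, m, hm, rfl⟩)
    · exact Or.inl (Or.inl ⟨_, hY, rfl⟩)
  · change opV ħ (-Y') (opM (B⁻¹ * C) hL m (opV ħ Y _)) = _
    rw [h1, h2, h3]

end Metaplectic

end

theorem mainTheorem9 (n : ℕ) (ħ : ℝ) (hħ : 0 < ħ) :
    (∀ S ∈ Metaplectic.Mp n hħ, ∀ ψ ∈ Metaplectic.Gauss₀ n hħ,
      S ψ ∈ Metaplectic.Gauss₀ n hħ) ∧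
    (∀ (X Y X' Y' : Matrix (Fin n) (Fin n) ℝ) (hX : X.PosDef) (hX' : X'.PosDef),
      Y.IsSymm → Y'.IsSymm →
      ∃ S ∈ Metaplectic.Mp n hħ, ∃ γ : ℝ,
        S (Metaplectic.gauss hħ hX Y 0) =
          Complex.I ^ (γ : ℂ) • Metaplectic.gauss hħ hX' Y' 0) := by
  refine ⟨fun S hS ψ hψ => (Metaplectic.preservesGauss_of_mem_Mp hS ψ).2 hψ, ?_⟩
  intro X Y X' Y' hX hX' hY hY'
  obtain ⟨S, hS, γ, h⟩ := Metaplectic.exists_mem_Mp_map_gauss hħ hX hX' hY hY'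
  exact ⟨S, hS, γ, by rw [h, ← Metaplectic.gauss_add, add_zero]⟩
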